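/- Let $\tau$ be a finite vocabulary (finitely many predicate, function and constant symbols; all structures have non-empty universe), and let $\phi$ be a first-order $\tau$-sentence (with equality). For $k\in\mathbb{N}=\{0,1,2,\ldots\}$, a $\tau$-structure $M$ is a $k$-ary covered extension of a non-empty collection $R$ of $\tau$-structures if every $N\in R$ is a substructure of $M$ and for every subset $A$ of the universe of $M$ with $|A|\le k$ there is some $N\in R$ whose universe contains $A$. The sentence $\phi$ is in $PCE(k)$ if, whenever $M$ is a $k$-ary covered extension of a collection $R$ of models of $\phi$, then $M\models\phi$; and $PCE=\bigcup_{k\ge 0}PCE(k)$. Then $\phi$ is in $PCE$ if and only if $\phi$ is equivalent (over all $\tau$-structures) to a $\Pi^0_2$ sentence, i.e. a sentence of the form $\forall x_1\ldots\forall x_n\exists y_1\ldots\exists y_m\,\theta$ with $n,m\ge 0$ and $\theta$ quantifier-free. -/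

import Mathlib

open FirstOrder CategoryTheory

universe u v w

namespace FirstOrder.Language

variable {L : Language.{u, v}}

/-- A formula of the form `∀ x₁ … ∀ xₙ ∃ y₁ … ∃ yₘ θ` with `θ` quantifier-free; either block of
quantifiers may be empty. -/
inductive BoundedFormula.IsPiTwo {α : Type w} : ∀ {n : ℕ}, L.BoundedFormula α n → Prop
  | of_isExistential {n : ℕ} {φ : L.BoundedFormula α n} (h : φ.IsExistential) : IsPiTwo φ
  | all {n : ℕ} {φ : L.BoundedFormula α (n + 1)} (h : IsPiTwo φ) : IsPiTwo φ.all

/-- `R` is a `k`-ary cover of `M`, that is, `M` is a `k`-ary covered extension of `R`: `R` is a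
nonempty collection of substructures of `M`, and every set of at most `k` elements of `M` is
contained in a member of `R`. As usual, the universe of a structure is not empty; since Mathlib's
substructures may be empty, this is required of the members of `R` explicitly. -/
structure IsKAryCover (k : ℕ) (M : Type w) [L.Structure M] (R : Set (L.Substructure M)) :
    Prop where
  nonempty : R.Nonempty
  nonempty_of_mem : ∀ N ∈ R, (N : Set M).Nonempty
  exists_subset : ∀ A : Finset M, A.card ≤ k → ∃ N ∈ R, (A : Set M) ⊆ (N : Set M)

/-- The class `S` of structures (closed under isomorphism) is preserved under `k`-ary covered
extensions: a (nonempty) structure that has a `k`-ary cover by structures of `S` is in `S`. -/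
def PreservedUnderKAryCoveredExtensions (k : ℕ) (S : Set (Bundled.{w} L.Structure)) : Prop :=
  ∀ (M : Type w) [L.Structure M] (R : Set (L.Substructure M)), IsKAryCover k M R →
    (∀ N ∈ R, (⟨↥N, inferInstance⟩ : Bundled.{w} L.Structure) ∈ S) →
    (⟨M, inferInstance⟩ : Bundled.{w} L.Structure) ∈ S

/-- The sentence `φ` is in `PCE(k)`: the class of its models is preserved under `k`-ary covered
extensions. -/
def Sentence.InPCEk (k : ℕ) (φ : L.Sentence) : Prop :=
  PreservedUnderKAryCoveredExtensions.{u, v, w} k {M : Bundled.{w} L.Structure | M ⊨ φ}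

/-- The sentence `φ` is in `PCE`, the union of the classes `PCE(k)` over all natural `k`. -/
def Sentence.InPCE (φ : L.Sentence) : Prop :=
  ∃ k : ℕ, Sentence.InPCEk.{u, v, w} k φ

end FirstOrder.Language

/-!
A `∀∃` sentence with `k` universal quantifiers is preserved under `k`-ary covered extensions: a
`k`-tuple lies in a member of the cover, which has the required witnesses, and existential formulas
persist to extensions (`BoundedFormula.IsPiTwo.exists_forall_realize`).

Conversely, let `φ` be in `PCE(k)`. If `φ` is not equivalent to a sentence `∀ x₁ … xₖ ∃ y, θ` with
`θ` quantifier-free, then each finite set of consequences of `φ` of this form has a model in which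
`φ` fails. As the language is countable, the consequences can be enumerated, and the ultraproduct
`P` over `ℕ` of such models for longer and longer initial segments satisfies all of them, but not `φ`.
It remains to see that every `k`-tuple `a` of `P` lies in a substructure that is a model of `φ`,
for then these substructures form a `k`-ary cover of `P`, and `P ⊨ φ`, a contradiction.

To find the substructure (`exists_substructure_realize`), consider the existential formulas that
fail at `a`. No finite disjunction of them is a consequence of `φ` for all tuples, so `φ` has a
model `N`, which may be taken countable, with a tuple `b` at which all of them fail. Hence every
existential formula true of `b` in `N` is true of `a` in `P`. Ultraproducts over `ℕ` are
`ℵ₁`-saturated (`exists_forall_realize_of_forall_le`), so the quantifier-free diagram of `N` can be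
realized in `P` over `a`, which embeds `N` in `P` with `b` going to `a`
(`exists_embedding_ultraproduct`).

Existential blocks are indexed by `ℕ` throughout, although a formula only uses finitely many of
these variables (`ForallExists`). Actual prenex sentences only appear through
`Formula.forallExists`.
-/

universe w'

namespace FirstOrder.Language

variable {L : Language.{u, v}}

open Filter

/-! ### Syntactic classes of formulas -/

namespace BoundedFormula

theorem IsExistential.relabel {α β : Type*} {n m : ℕ} {φ : L.BoundedFormula α m}
    (h : φ.IsExistential) (f : α → β ⊕ Fin n) : (φ.relabel f).IsExistential := by
  induction h with
  | of_isQF h => exact (h.relabel f).isExistential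
  | ex _ ih => simpa using ih.ex

theorem IsExistential.exs {α : Type*} {n : ℕ} {φ : L.BoundedFormula α n}
    (h : φ.IsExistential) : IsExistential φ.exs := by
  induction n with
  | zero => exact h
  | succ n ih => exact ih h.ex

theorem IsPiTwo.alls {α : Type*} {n : ℕ} {φ : L.BoundedFormula α n}
    (h : φ.IsPiTwo) : IsPiTwo φ.alls := by
  induction n with
  | zero => exact h
  | succ n ih => exact ih h.all

end BoundedFormula

theorem Formula.realize_congr_freeVarFinset {α M : Type*} [L.Structure M] [DecidableEq α]
    (φ : L.Formula α) {v v' : α → M}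
    (h : ∀ a ∈ BoundedFormula.freeVarFinset φ, v a = v' a) : φ.Realize v ↔ φ.Realize v' :=
  (BoundedFormula.realize_restrictFreeVar (φ := φ) (f := id) (v := fun a => v a) v
    fun _ => rfl).symm.trans
    (BoundedFormula.realize_restrictFreeVar v' fun a => h a a.2)

/-- The conjunction of the first `n` formulas of a sequence. -/
def Formula.conj {β : Type*} (d : ℕ → L.Formula β) : ℕ → L.Formula β
  | 0 => ⊤
  | n + 1 => Formula.conj d n ⊓ d n

theorem Formula.isQF_conj {β : Type*} {d : ℕ → L.Formula β} (hd : ∀ j, (d j).IsQF) (n : ℕ) :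
    (Formula.conj d n).IsQF := by
  induction n with
  | zero => exact BoundedFormula.IsQF.top
  | succ n ih => exact ih.inf (hd n)

theorem Formula.realize_conj {β M : Type*} [L.Structure M] {d : ℕ → L.Formula β} {n : ℕ}
    {v : β → M} : (Formula.conj d n).Realize v ↔ ∀ j < n, (d j).Realize v := by
  induction n with
  | zero => simp [Formula.conj]
  | succ n ih => rw [Formula.conj, Formula.realize_inf, ih, Nat.forall_lt_succ_right]

/-- The disjunction of the first `n` formulas of a sequence. -/
def Formula.disj {β : Type*} (d : ℕ → L.Formula β) : ℕ → L.Formula β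
  | 0 => ⊥
  | n + 1 => Formula.disj d n ⊔ d n

theorem Formula.isQF_disj {β : Type*} {d : ℕ → L.Formula β} (hd : ∀ j, (d j).IsQF) (n : ℕ) :
    (Formula.disj d n).IsQF := by
  induction n with
  | zero => exact BoundedFormula.isQF_bot
  | succ n ih => exact ih.sup (hd n)

theorem Formula.realize_disj {β M : Type*} [L.Structure M] {d : ℕ → L.Formula β} {n : ℕ}
    {v : β → M} : (Formula.disj d n).Realize v ↔ ∃ j < n, (d j).Realize v := by
  induction n with
  | zero => simp [Formula.disj]
  | succ n ih => rw [Formula.disj, Formula.realize_sup, ih, Nat.exists_lt_succ_right]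

/-! ### `∀∃` conditions -/

/-- The condition `∀ x ∃ y, θ(x, y)` on a structure `M`. The existential block is indexed by `ℕ`, of
which `θ` only uses a finite part, so that all conditions with the same `α` share one set of
variables. -/
def ForallExists {α : Type*} (θ : L.Formula (α ⊕ ℕ)) (M : Type*) [L.Structure M] : Prop :=
  ∀ a : α → M, ∃ y : ℕ → M, θ.Realize (Sum.elim a y)

/-- The largest `j` such that the variable `y j` occurs in `θ(x, y)`, or `0` if there is none. -/
def Formula.maxVar {k : ℕ} (θ : L.Formula (Fin k ⊕ ℕ)) : ℕ :=
  (BoundedFormula.freeVarFinset θ).toRight.sup id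

theorem Formula.le_maxVar {k : ℕ} {θ : L.Formula (Fin k ⊕ ℕ)} {j : ℕ}
    (h : Sum.inr j ∈ BoundedFormula.freeVarFinset θ) : j ≤ θ.maxVar :=
  Finset.le_sup (f := id) (Finset.mem_toRight.2 h)

/-- The sentence expressing the condition `∀ x ∃ y, θ(x, y)`; the existential block is cut off after
the last variable that occurs in `θ`, but keeps at least one variable, onto which the variables that
do not occur can be mapped. -/
noncomputable def Formula.forallExists {k : ℕ} (θ : L.Formula (Fin k ⊕ ℕ)) : L.Sentence :=
  BoundedFormula.alls (BoundedFormula.relabel (Sum.inr : Fin k → Empty ⊕ Fin k)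
    (Formula.iExs (Fin (θ.maxVar + 1)) (θ.relabel (Sum.map id (Fin.ofNat (θ.maxVar + 1))))))

theorem Formula.isPiTwo_forallExists {k : ℕ} {θ : L.Formula (Fin k ⊕ ℕ)} (hθ : θ.IsQF) :
    BoundedFormula.IsPiTwo θ.forallExists := by
  have hη : (θ.relabel (Sum.map id (Fin.ofNat (θ.maxVar + 1)))).IsQF := hθ.relabel _
  exact .alls (.of_isExistential (.relabel (.exs (.of_isQF (hη.relabel _))) _))

theorem Formula.realize_forallExists {k : ℕ} (θ : L.Formula (Fin k ⊕ ℕ)) (M : Type*)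
    [L.Structure M] : M ⊨ θ.forallExists ↔ ForallExists θ M := by
  rw [Sentence.Realize, forallExists, BoundedFormula.realize_alls]
  refine forall_congr' fun a => (Formula.realize_relabel_sumInr _).trans ?_
  simp only [Formula.realize_iExs, Formula.realize_relabel, Sum.elim_comp_map, Function.comp_id]
  constructor
  · rintro ⟨y, hy⟩
    exact ⟨_, hy⟩
  · rintro ⟨y, hy⟩
    refine ⟨fun i => y i, (θ.realize_congr_freeVarFinset ?_).1 hy⟩
    rintro (t | j) hj
    · rfl
    · simp [Nat.mod_eq_of_lt (Nat.lt_succ_of_le (le_maxVar hj))]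

/-- Finite conjunctions of conditions `∀ x ∃ y, θ(x, y)` are again of that form: rename the
existential variables of the conjuncts apart by a pairing function. -/
theorem exists_isQF_forallExists_iff_forall_lt {α : Type*} (χ : ℕ → L.Formula (α ⊕ ℕ))
    (hχ : ∀ j, (χ j).IsQF) (n : ℕ) :
    ∃ θ : L.Formula (α ⊕ ℕ), θ.IsQF ∧ ∀ (M : Type w) [L.Structure M] [Nonempty M],
      ForallExists θ M ↔ ∀ j < n, ForallExists (χ j) M := by
  refine ⟨Formula.conj (fun j => (χ j).relabel (Sum.map id (Nat.pair j))) n,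
    Formula.isQF_conj (fun j => (hχ j).relabel _) n, fun M _ _ => ?_⟩
  simp only [ForallExists, Formula.realize_conj, Formula.realize_relabel, Sum.elim_comp_map,
    Function.comp_id]
  constructor
  · intro h j hj a
    obtain ⟨y, hy⟩ := h a
    exact ⟨_, hy j hj⟩
  · intro h a
    choose! y hy using fun j hj => h j hj a
    refine ⟨fun i => y i.unpair.1 i.unpair.2, fun j hj => ?_⟩
    have : (fun i : ℕ => y i.unpair.1 i.unpair.2) ∘ Nat.pair j = y j := by
      ext i; simp
    rw [this]
    exact hy j hj

/-! ### Countable elementary substructures -/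

theorem exists_countable_elementarySubstructure [Countable L.Symbols] {M : Type*} [L.Structure M]
    [Nonempty M] {s : Set M} (hs : s.Countable) :
    ∃ S : L.ElementarySubstructure M, s ⊆ S ∧ Countable S := by
  have : Countable (Σ l, (L.sum L.skolem₁).Functions l) := by
    rw [← Cardinal.mk_le_aleph0_iff]
    refine card_functions_sum_skolem₁_le.trans (max_le le_rfl ?_)
    exact Cardinal.mk_le_aleph0_iff.2 ‹_›
  exact ⟨(Substructure.closure (L.sum L.skolem₁) s).elementarySkolem₁Reduct,
    Substructure.subset_closure, hs.substructure_closure (L.sum L.skolem₁)⟩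

/-- A countable language has, in every universe, a structure elementarily equivalent to a given
one; a countable elementary substructure can be moved between universes. -/
theorem exists_elementarilyEquivalent_type [Countable L.Symbols] (M : Type w') [L.Structure M]
    [Nonempty M] : ∃ N : Bundled.{w} L.Structure, Nonempty N ∧ (N ≅[L] M) := by
  obtain ⟨S, -, hS⟩ := exists_countable_elementarySubstructure (L := L) (M := M) Set.countable_empty
  have : Small.{w} S := Countable.toSmall S
  let g : S ≃ Shrink.{w} S := equivShrink S
  let : L.Structure (Shrink.{w} S) := g.inducedStructure
  have e : S ≃[L] Shrink.{w} S := g.inducedStructureEquiv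
  exact ⟨⟨Shrink.{w} S, inferInstance⟩, g.nonempty_congr.1 inferInstance,
    (StrongHomClass.elementarilyEquivalent e).symm.trans S.elementarilyEquivalent⟩

/-! ### Embeddings from diagrams -/

/-- A map `n ↦ z n` on an enumeration `e` of `N` that preserves quantifier-free formulas, with
parameters `b ↦ a`, induces an embedding. -/
theorem exists_embedding_of_realize {α M N : Type*} [L.Structure M] [L.Structure N]
    {b : α → N} {a : α → M} {e : ℕ → N} (he : Function.Surjective e) {z : ℕ → M}
    (h : ∀ θ : L.Formula (α ⊕ ℕ), θ.IsQF → θ.Realize (Sum.elim b e) → θ.Realize (Sum.elim a z)) :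
    ∃ f : N ↪[L] M, ∀ t, f (b t) = a t := by
  -- Quantifier-free formulas are closed under negation, so they are also reflected.
  have hiff (θ : L.Formula (α ⊕ ℕ)) (hθ : θ.IsQF) :
      θ.Realize (Sum.elim a z) ↔ θ.Realize (Sum.elim b e) :=
    ⟨fun H => by_contra fun H' => h _ hθ.not H' H, h θ hθ⟩
  have heq (s t : L.Term (α ⊕ ℕ)) : s.realize (Sum.elim a z) = t.realize (Sum.elim a z) ↔
      s.realize (Sum.elim b e) = t.realize (Sum.elim b e) := by
    simpa only [Formula.realize_equal] using
      hiff (s.equal t) (BoundedFormula.IsAtomic.equal _ _).isQF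
  let i := Function.surjInv he
  have hi (x : N) : e (i x) = x := Function.surjInv_eq he x
  refine ⟨⟨⟨fun x => z (i x), fun x y hxy => ?_⟩, fun {n} F x => ?_, fun {n} R x => ?_⟩, fun t => ?_⟩
  · simpa [hi] using (heq (Term.var (.inr (i x))) (Term.var (.inr (i y)))).1 hxy
  · simpa [Function.comp_def] using (heq (Term.var (.inr (i (Structure.funMap F x))))
      (Term.func F fun j => Term.var (.inr (i (x j))))).2 (by simp [hi])
  · have := hiff (R.formula fun j => Term.var (.inr (i (x j)))) (R.isQF _)
    simpa [Formula.realize_rel, hi, Function.comp_def] using this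
  · exact (heq (Term.var (.inr (i (b t)))) (Term.var (.inl t))).2 (by simp [hi])

/-! ### Ultraproducts over `ℕ` -/

section Ultraproduct

variable {M : ℕ → Type w} [∀ i, L.Structure (M i)] [∀ i, Nonempty (M i)] {α : Type*}

omit [∀ i, Nonempty (M i)] in
theorem exists_coe_comp_eq {β : Type*} (a : β → (hyperfilter ℕ : Filter ℕ).Product M) :
    ∃ x : β → ∀ i, M i, a = fun t => (x t : (hyperfilter ℕ : Filter ℕ).Product M) :=
  ⟨fun t => (a t).out, funext fun _ => (Quotient.out_eq _).symm⟩

theorem realize_sumElim_cast (θ : L.Formula (α ⊕ ℕ)) (x : α → ∀ i, M i) (y : ℕ → ∀ i, M i) :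
    θ.Realize (Sum.elim (fun t => (x t : (hyperfilter ℕ : Filter ℕ).Product M))
      (fun j => (y j : (hyperfilter ℕ : Filter ℕ).Product M))) ↔
    ∀ᶠ i in (hyperfilter ℕ : Filter ℕ),
      θ.Realize (Sum.elim (fun t => x t i) (fun j => y j i)) := by
  have h1 := Ultraproduct.realize_formula_cast (u := hyperfilter ℕ) θ (Sum.elim x y)
  have h2 : (fun s : α ⊕ ℕ => ((Sum.elim x y s : ∀ i, M i) :
      (hyperfilter ℕ : Filter ℕ).Product M)) =
      Sum.elim (fun t => (x t : (hyperfilter ℕ : Filter ℕ).Product M))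
        (fun j => (y j : (hyperfilter ℕ : Filter ℕ).Product M)) := by
    ext (t | j) <;> rfl
  have h3 (i : ℕ) : (fun s : α ⊕ ℕ => Sum.elim x y s i) =
      Sum.elim (fun t => x t i) (fun j => y j i) := by
    ext (t | j) <;> rfl
  simpa only [h2, h3] using h1

/-- Łoś's theorem for `∃ y, θ(x, y)`, where the block `y` is indexed by `ℕ`. -/
theorem exists_realize_cast (θ : L.Formula (α ⊕ ℕ)) (x : α → ∀ i, M i) :
    (∃ y, θ.Realize (Sum.elim (fun t => (x t : (hyperfilter ℕ : Filter ℕ).Product M)) y)) ↔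
    ∀ᶠ i in (hyperfilter ℕ : Filter ℕ), ∃ y, θ.Realize (Sum.elim (fun t => x t i) y) := by
  constructor
  · rintro ⟨y, hy⟩
    obtain ⟨y, rfl⟩ := exists_coe_comp_eq y
    exact ((realize_sumElim_cast θ x y).1 hy).mono fun i hi => ⟨_, hi⟩
  · intro h
    have (i : ℕ) : ∃ y : ℕ → M i, (∃ y, θ.Realize (Sum.elim (fun t => x t i) y)) →
        θ.Realize (Sum.elim (fun t => x t i) y) := by
      by_cases hi : ∃ y, θ.Realize (Sum.elim (fun t => x t i) y)
      · exact ⟨hi.choose, fun _ => hi.choose_spec⟩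
      · exact ⟨fun _ => Classical.arbitrary _, fun h => (hi h).elim⟩
    choose y hy using this
    exact ⟨_, (realize_sumElim_cast θ x fun j i => y i j).2 (h.mono hy)⟩

/-- An ultraproduct over `ℕ` is `ℵ₁`-saturated: a countable set of formulas in the variables `y`
with parameters `a` that is finitely satisfiable is satisfiable. The witnesses in the `i`-th factor
satisfy the longest initial segment of length at most `i` that can be satisfied there. -/
theorem exists_forall_realize_of_forall_le (a : α → (hyperfilter ℕ : Filter ℕ).Product M)
    (d : ℕ → L.Formula (α ⊕ ℕ))
    (h : ∀ m, ∃ y, ∀ j ≤ m, (d j).Realize (Sum.elim a y)) :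
    ∃ y, ∀ j, (d j).Realize (Sum.elim a y) := by
  classical
  obtain ⟨x, rfl⟩ := exists_coe_comp_eq a
  let P (i m : ℕ) : Prop := ∃ y, ∀ j ≤ m, (d j).Realize (Sum.elim (fun t => x t i) y)
  have hP (m : ℕ) : ∀ᶠ i in (hyperfilter ℕ : Filter ℕ), P i m := by
    obtain ⟨y, hy⟩ := h m
    obtain ⟨y, rfl⟩ := exists_coe_comp_eq y
    have := (eventually_all_finite (Set.finite_Iic m)).2
      fun j hj => (realize_sumElim_cast (d j) x y).1 (hy j hj)
    exact this.mono fun i hi => ⟨_, hi⟩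
  have (i : ℕ) : ∃ y : ℕ → M i, ∀ m ≤ i, P i m → (d m).Realize (Sum.elim (fun t => x t i) y) := by
    by_cases hi : ∃ m ≤ i, P i m
    · obtain ⟨m, hm, hPm⟩ := hi
      obtain ⟨y, hy⟩ : P i (Nat.findGreatest (P i) i) := Nat.findGreatest_spec hm hPm
      exact ⟨y, fun j hj hPj => hy j (Nat.le_findGreatest hj hPj)⟩
    · exact ⟨fun _ => Classical.arbitrary _, fun m hm hPm => (hi ⟨m, hm, hPm⟩).elim⟩
  choose y hy using this
  refine ⟨_, fun j => (realize_sumElim_cast (d j) x fun n i => y i n).2 ?_⟩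
  filter_upwards [hP j, Nat.hyperfilter_le_atTop (eventually_ge_atTop j)] with i h1 h2
    using hy i j h2 h1

/-- A countable structure `N` with parameters `b` embeds into an ultraproduct over `ℕ`, sending `b`
to `a`, as soon as every existential formula true of `b` is true of `a`. -/
theorem exists_embedding_ultraproduct [Countable L.Symbols] [Countable α] {N : Type*}
    [L.Structure N] [Nonempty N] [Countable N] (b : α → N)
    (a : α → (hyperfilter ℕ : Filter ℕ).Product M)
    (h : ∀ θ : L.Formula (α ⊕ ℕ), θ.IsQF → (∃ y, θ.Realize (Sum.elim b y)) →
      ∃ y, θ.Realize (Sum.elim a y)) :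
    ∃ f : N ↪[L] (hyperfilter ℕ : Filter ℕ).Product M, ∀ t, f (b t) = a t := by
  obtain ⟨e, he⟩ := exists_surjective_nat N
  let D := {θ : L.Formula (α ⊕ ℕ) // θ.IsQF ∧ θ.Realize (Sum.elim b e)}
  have : Countable D := inferInstanceAs (Countable (Subtype _))
  have : Nonempty D := ⟨⟨⊤, .top, Formula.realize_top.2 trivial⟩⟩
  obtain ⟨d, hd⟩ := exists_surjective_nat D
  obtain ⟨z, hz⟩ := exists_forall_realize_of_forall_le a (fun j => (d j).1) fun m => by
    obtain ⟨y, hy⟩ := h (Formula.conj (fun j => (d j).1) (m + 1))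
      (Formula.isQF_conj (fun j => (d j).2.1) _) ⟨e, Formula.realize_conj.2 fun j _ => (d j).2.2⟩
    exact ⟨y, fun j hj => Formula.realize_conj.1 hy j (Nat.lt_succ_of_le hj)⟩
  refine exists_embedding_of_realize he (z := z) fun θ hθ hr => ?_
  obtain ⟨j, hj⟩ := hd ⟨θ, hθ, hr⟩
  simpa [hj] using hz j

end Ultraproduct

/-! ### Covers by models -/

/-- If a tuple `a` of an ultraproduct over `ℕ` satisfies every existential formula that `φ` forces
on all tuples of its models, then `a` lies in a substructure that is a model of `φ`. Indeed, no
finite disjunction of existential formulas failing at `a` is forced by `φ`, so an ultraproduct of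
counterexamples is a model of `φ` with a tuple `b` at which all of these formulas fail. -/
theorem exists_substructure_realize [Countable L.Symbols] {M : ℕ → Type w}
    [∀ i, L.Structure (M i)] [∀ i, Nonempty (M i)] {α : Type*} [Countable α] (φ : L.Sentence)
    (a : α → (hyperfilter ℕ : Filter ℕ).Product M)
    (h : ∀ θ : L.Formula (α ⊕ ℕ), θ.IsQF →
      (∀ (N : Type max u v) [L.Structure N] [Nonempty N], N ⊨ φ → ForallExists θ N) →
      ∃ y, θ.Realize (Sum.elim a y)) :
    ∃ S : L.Substructure ((hyperfilter ℕ : Filter ℕ).Product M),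
      (∀ t, a t ∈ S) ∧ (S : Set ((hyperfilter ℕ : Filter ℕ).Product M)).Nonempty ∧ S ⊨ φ := by
  -- Formulas whose existential closures fail at `a`.
  let E := {θ : L.Formula (α ⊕ ℕ) // θ.IsQF ∧ ¬ ∃ y, θ.Realize (Sum.elim a y)}
  have : Countable E := inferInstanceAs (Countable (Subtype _))
  have : Nonempty E := ⟨⟨⊥, BoundedFormula.isQF_bot, fun ⟨_, hy⟩ => Formula.realize_bot.1 hy⟩⟩
  obtain ⟨e, he⟩ := exists_surjective_nat E
  have counterexample (m : ℕ) : ∃ N : Bundled.{max u v} L.Structure, Nonempty N ∧ N ⊨ φ ∧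
      ∃ b : α → N, ∀ j < m, ¬ ∃ y, (e j).1.Realize (Sum.elim b y) := by
    by_contra! hm
    obtain ⟨y, hy⟩ := h (Formula.disj (fun j => (e j).1) m)
      (Formula.isQF_disj (fun j => (e j).2.1) m) fun N _ _ hN b => by
        obtain ⟨j, hj, y, hy⟩ := hm ⟨N, inferInstance⟩ inferInstance hN b
        exact ⟨y, Formula.realize_disj.2 ⟨j, hj, hy⟩⟩
    obtain ⟨j, -, hj⟩ := Formula.realize_disj.1 hy
    exact (e j).2.2 ⟨y, hj⟩
  choose N hN hNφ b hb using counterexample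
  -- The countable `S` contains the tuple `b'` and is elementary in the ultraproduct of the `N m`.
  let b' : α → (hyperfilter ℕ : Filter ℕ).Product fun m => N m := fun t => fun m => b m t
  obtain ⟨S, hbS, hS⟩ := exists_countable_elementarySubstructure (L := L) (Set.countable_range b')
  obtain ⟨f, hf⟩ := exists_embedding_ultraproduct (N := S)
    (fun t => ⟨b' t, hbS ⟨t, rfl⟩⟩) a fun θ hθ hθb => by
      obtain ⟨y, hy⟩ := hθb
      by_contra hθa
      obtain ⟨j, hj⟩ := he ⟨θ, hθ, hθa⟩
      have hb' : ∃ y, θ.Realize (Sum.elim b' y) := by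
        refine ⟨fun n => y n, ?_⟩
        rw [← S.subtype.map_formula] at hy
        rwa [Sum.comp_elim] at hy
      have := (exists_realize_cast θ fun t m => b m t).1 hb'
      obtain ⟨m, ⟨y, hy⟩, hm⟩ :=
        (this.and (Nat.hyperfilter_le_atTop (eventually_gt_atTop j))).exists
      exact hb m j hm ⟨y, by simpa [hj] using hy⟩
  refine ⟨f.toHom.range, fun t => ⟨_, hf t⟩, ?_, ?_⟩
  · exact ⟨f (Classical.arbitrary S), _, rfl⟩
  · rw [← StrongHomClass.realize_sentence f.equivRange φ, S.realize_sentence,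
      Ultraproduct.sentence_realize]
    exact Eventually.of_forall hNφ

/-- A sentence in `PCE(k)` is equivalent to a `∀∃` sentence with `k` universal quantifiers. Models
of the consequences of `φ` of this form come from the universe `max u v` of semantic consequence, and
are replaced by elementarily equivalent ones in the universe `w` in which `φ` is preserved. -/
theorem exists_forallExists_iff_of_inPCEk [Countable L.Symbols] {k : ℕ} {φ : L.Sentence}
    (hφ : Sentence.InPCEk.{u, v, w} k φ) :
    ∃ θ : L.Formula (Fin k ⊕ ℕ), θ.IsQF ∧
      ∀ (M : Type max u v) [L.Structure M] [Nonempty M], M ⊨ φ ↔ ForallExists θ M := by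
  by_contra! hcon
  -- The consequences `∀ x ∃ y, θ(x, y)` of `φ`.
  let X := {θ : L.Formula (Fin k ⊕ ℕ) // θ.IsQF ∧
    ∀ (N : Type max u v) [L.Structure N] [Nonempty N], N ⊨ φ → ForallExists θ N}
  have : Countable X := inferInstanceAs (Countable (Subtype _))
  have : Nonempty X := ⟨⟨⊤, .top, fun N _ _ _ _ =>
    ⟨fun _ => Classical.arbitrary N, Formula.realize_top.2 trivial⟩⟩⟩
  obtain ⟨χ, hχ⟩ := exists_surjective_nat X
  have counterexample (m : ℕ) : ∃ M : Bundled.{w} L.Structure, Nonempty M ∧ ¬ M ⊨ φ ∧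
      ∀ j < m, ForallExists (χ j).1 M := by
    obtain ⟨θ, hθ, hθχ⟩ := exists_isQF_forallExists_iff_forall_lt (fun j => (χ j).1)
      (fun j => (χ j).2.1) m
    obtain ⟨M₀, _, _, hM₀⟩ := hcon θ hθ
    have hX : M₀ ⊨ φ → ForallExists θ M₀ := fun H =>
      (hθχ M₀).2 fun j _ => (χ j).2.2 M₀ H
    have hM₀θ : ForallExists θ M₀ ∧ ¬ M₀ ⊨ φ := by tauto
    obtain ⟨M, hM, hMM₀⟩ := exists_elementarilyEquivalent_type.{u, v, w} (L := L) M₀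
    refine ⟨M, hM, fun H => hM₀θ.2 ((hMM₀.realize_sentence φ).1 H), fun j hj => ?_⟩
    rw [← Formula.realize_forallExists, hMM₀.realize_sentence, Formula.realize_forallExists]
    exact (hθχ M₀).1 hM₀θ.1 j hj
  choose M hM hMφ hMχ using counterexample
  let P := (hyperfilter ℕ : Filter ℕ).Product fun m => M m
  have hP : ¬ P ⊨ φ := by
    rw [Ultraproduct.sentence_realize]
    exact fun H => H.exists.elim fun m hm => hMφ m hm
  have cover (a : Fin k → P) : ∃ S : L.Substructure P,
      (∀ t, a t ∈ S) ∧ (S : Set P).Nonempty ∧ S ⊨ φ := by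
    refine exists_substructure_realize φ a fun θ hθ hφθ => ?_
    obtain ⟨j, hj⟩ := hχ ⟨θ, hθ, hφθ⟩
    obtain ⟨x, rfl⟩ := exists_coe_comp_eq a
    refine (exists_realize_cast θ x).2 ?_
    filter_upwards [Nat.hyperfilter_le_atTop (eventually_gt_atTop j)] with m hm
    simpa [hj] using hMχ m j hm fun t => x t m
  refine hP (hφ P {S | (S : Set P).Nonempty ∧ S ⊨ φ} ⟨?_, fun N hN => hN.1, fun A hA => ?_⟩
    fun N hN => hN.2)
  · obtain ⟨S, -, hS⟩ := cover fun _ => Classical.arbitrary P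
    exact ⟨S, hS⟩
  · -- A set with at most `k` elements lies in the range of a `k`-tuple.
    obtain ⟨a, ha⟩ : ∃ a : Fin k → P, (A : Set P) ⊆ Set.range a := by
      refine ⟨fun t => if h : (t : ℕ) < A.card then A.equivFin.symm ⟨t, h⟩
        else Classical.arbitrary P, fun x hx => ?_⟩
      refine ⟨⟨A.equivFin ⟨x, hx⟩, (A.equivFin ⟨x, hx⟩).2.trans_le hA⟩, ?_⟩
      simp
    obtain ⟨S, haS, hS⟩ := cover a
    exact ⟨S, hS, ha.trans (Set.range_subset_iff.2 haS)⟩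

/-! ### Preservation of `∀∃` sentences -/

namespace BoundedFormula

/-- With `k` the number of universal quantifiers, a `∀∃` formula holds at a tuple `xs` of `M` if
every set of at most `k` elements is contained in a substructure that contains `xs` and in which the
formula holds at `xs`. Each
universal quantifier moves one element of the set into the tuple. -/
theorem IsPiTwo.exists_forall_realize {n : ℕ} {ψ : L.BoundedFormula Empty n} (hψ : ψ.IsPiTwo) :
    ∃ k : ℕ, ∀ (M : Type w) [L.Structure M] (xs : Fin n → M),
      (∀ A : Finset M, A.card ≤ k → ∃ (N : L.Substructure M) (ys : Fin n → N),
        (A : Set M) ⊆ N ∧ (∀ i, (ys i : M) = xs i) ∧ ψ.Realize default ys) →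
      ψ.Realize default xs := by
  induction hψ with
  | @of_isExistential n ψ h =>
    refine ⟨0, fun M _ xs H => ?_⟩
    obtain ⟨N, ys, -, hys, hN⟩ := H ∅ (by simp)
    have := h.realize_embedding N.subtype hN
    convert this using 1
    ext i
    exact (hys i).symm
  | @all n ψ h ih =>
    obtain ⟨k, hk⟩ := ih
    refine ⟨k + 1, fun M _ xs H x => hk M _ fun A hA => ?_⟩
    classical
    obtain ⟨N, ys, hAN, hys, hN⟩ := H (insert x A)
      ((Finset.card_insert_le _ _).trans (Nat.succ_le_succ hA))
    have hx : x ∈ N := hAN (by simp)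
    refine ⟨N, Fin.snoc ys ⟨x, hx⟩, fun y hy => hAN (by simp [Finset.mem_coe.1 hy]), fun i => ?_,
      hN ⟨x, hx⟩⟩
    refine Fin.lastCases ?_ (fun i => ?_) i
    · simp
    · simpa using hys i

end BoundedFormula

theorem Sentence.inPCE_of_isPiTwo {ψ : L.Sentence} (hψ : BoundedFormula.IsPiTwo ψ) :
    Sentence.InPCE.{u, v, w} ψ := by
  obtain ⟨k, hk⟩ := hψ.exists_forall_realize
  refine ⟨k, fun M _ R hR hψR => ?_⟩
  have := hk M default fun A hA => by
    obtain ⟨N, hN, hAN⟩ := hR.exists_subset A hA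
    exact ⟨N, default, hAN, fun i => i.elim0, hψR N hN⟩
  exact this

end FirstOrder.Language

theorem corollary5 (L : FirstOrder.Language.{u, v}) [Finite L.Symbols]
    (φ : L.Sentence) :
    FirstOrder.Language.Sentence.InPCE.{u, v, w} φ ↔
      ∃ ψ : L.Sentence, FirstOrder.Language.BoundedFormula.IsPiTwo ψ ∧ φ ⇔[∅] ψ := by
  constructor
  · rintro ⟨k, hk⟩
    obtain ⟨θ, hθ, hφθ⟩ := FirstOrder.Language.exists_forallExists_iff_of_inPCEk hk
    refine ⟨θ.forallExists, FirstOrder.Language.Formula.isPiTwo_forallExists hθ,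
      FirstOrder.Language.Theory.models_sentence_iff.2 fun M => ?_⟩
    exact FirstOrder.Language.BoundedFormula.realize_iff.2
      ((hφθ M).trans (θ.realize_forallExists M).symm)
  · rintro ⟨ψ, hψ, hφψ⟩
    obtain ⟨k, hk⟩ := FirstOrder.Language.Sentence.inPCE_of_isPiTwo.{u, v, w} hψ
    refine ⟨k, fun M _ R hR hφR => ?_⟩
    have hiff (N : Type w) [L.Structure N] [Nonempty N] : N ⊨ φ ↔ N ⊨ ψ :=
      hφψ.models_sentence_iff
    obtain ⟨N, hN⟩ := hR.nonempty
    have : Nonempty M := (hR.nonempty_of_mem N hN).to_type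
    refine (hiff M).2 (hk M R hR fun N hN => ?_)
    have := (hR.nonempty_of_mem N hN).to_subtype
    exact (hiff N).1 (hφR N hN)
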